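/- Let $d\ge 2$, let $\mathbb S^{d-1}$ be the unit sphere of $\mathbb R^d$, $\sigma$ its surface measure, $|\mathbb S^{d-1}|=\sigma(\mathbb S^{d-1})$, and $\mathcal U(\mathbb S^{d-1})=\sigma/|\mathbb S^{d-1}|$ the uniform distribution. Let $d_1:\mathbb R\times\mathbb R\to[0,\infty)$ be a Borel measurable pseudo-metric, i.e. non-negative, symmetric, and such that for some $C>0$, $d_1(x,z)\le C[d_1(x,y)+d_1(y,z)]$ for all $x,y,z$. Let $\beta\in[0,1]$. For probability measures $p,q$ on $\mathbb R$, with $\Pi(p,q)$ the set of their couplings, the fused Gromov Wasserstein discrepancy is $$D_{fgw}(p,q;\beta,d_1)=\inf_{\pi\in\Pi(p,q)}\Big\{(1-\beta)\int d_1(x,y)\,d\pi(x,y)+\beta\int\!\!\int\big[d_1(x,x')-d_1(y,y')\big]^2d\pi(x,y)\,d\pi(x',y')\Big\}\in[0,\infty].$$ For $\theta\in\mathbb S^{d-1}$ let $\theta\sharp\mu$ be the push-forward of $\mu$ under $x\mapsto\theta^\top x$. For $\kappa\ge0$ and $\epsilon\in\mathbb S^{d-1}$ let $\mathrm{PS}(\cdot|\epsilon,\kappa)$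 be the power spherical distribution, with density $C(\kappa,d)(1+\epsilon^\top x)^\kappa$ with respect to $\sigma$, where $$C(\kappa,d)=\Big\{2^{d-1+\kappa}\,\pi^{\frac{d-1}2}\,\frac{\Gamma(\frac{d-1}2+\kappa)}{\Gamma(d-1+\kappa)}\Big\}^{-1}.$$ For Borel probability measures $\mu,\nu$ on $\mathbb R^d$ define, with values in $[0,\infty]$, $$\mathrm{SFG}(\mu,\nu;\beta)=\mathbb E_{\theta\sim\mathcal U(\mathbb S^{d-1})}\big[D_{fgw}(\theta\sharp\mu,\theta\sharp\nu;\beta,d_1)\big],\qquad \text{max-SFG}(\mu,\nu;\beta)=\sup_{\theta\in\mathbb S^{d-1}}D_{fgw}(\theta\sharp\mu,\theta\sharp\nu;\beta,d_1),$$ $$\mathrm{PSSFG}(\mu,\nu;\beta,\kappa)=\sup_{\epsilon\in\mathbb S^{d-1}}\mathbb E_{\theta\sim\mathrm{PS}(\cdot|\epsilon,\kappa)}\big[D_{fgw}(\theta\sharp\mu,\theta\sharp\nu;\beta,d_1)\big].$$ Then for all Borel probability measures $\mu,\nu$ on $\mathbb R^d$: (a) $\lim_{\kappa\to0^+}\mathrm{PSSFG}(\mu,\nu;\beta,\kappa)=\mathrm{SFG}(\mu,\nu;\beta)$,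 and, if $d_1$ is continuous, $\lim_{\kappa\to\infty}\mathrm{PSSFG}(\mu,\nu;\beta,\kappa)=\text{max-SFG}(\mu,\nu;\beta)$. (b) For every $\kappa>0$, $$\mathrm{PSSFG}(\mu,\nu;\beta,\kappa)\le 2^\kappa\,C(\kappa,d)\,|\mathbb S^{d-1}|\;\mathrm{SFG}(\mu,\nu;\beta),\qquad \mathrm{PSSFG}(\mu,\nu;\beta,\kappa)\le\text{max-SFG}(\mu,\nu;\beta).$$ -/

import Mathlib

open MeasureTheory Set Filter Topology
open scoped ENNReal

noncomputable section

/-- A pseudo-metric on the real line: non-negative, symmetric, and satisfying the triangle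
inequality up to a multiplicative constant. -/
structure IsPseudoMetricOnReal (d₁ : ℝ → ℝ → ℝ) : Prop where
  nonneg : ∀ x y, 0 ≤ d₁ x y
  symm : ∀ x y, d₁ x y = d₁ y x
  weak_triangle : ∃ C : ℝ, 0 < C ∧ ∀ x y z, d₁ x z ≤ C * (d₁ x y + d₁ y z)

/-- The transport plans between two measures on the line. -/
def transportPlans (p q : Measure ℝ) : Set (Measure (ℝ × ℝ)) :=
  {π | π.map Prod.fst = p ∧ π.map Prod.snd = q}

/-- The fused Gromov Wasserstein objective of a plan `π`. In the second integral `z.1 = (x, y)` and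
`z.2 = (x', y')` are independent with law `π`. Values are in `[0, ∞]`. -/
def fgwCost (d₁ : ℝ → ℝ → ℝ) (β : ℝ) (π : Measure (ℝ × ℝ)) : ℝ≥0∞ :=
  ENNReal.ofReal (1 - β) * ∫⁻ z, ENNReal.ofReal (d₁ z.1 z.2) ∂π
    + ENNReal.ofReal β *
        ∫⁻ z, ENNReal.ofReal ((d₁ z.1.1 z.2.1 - d₁ z.1.2 z.2.2) ^ 2) ∂(π.prod π)

/-- The fused Gromov Wasserstein discrepancy between two measures on the line. -/
def fgw (d₁ : ℝ → ℝ → ℝ) (β : ℝ) (p q : Measure ℝ) : ℝ≥0∞ :=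
  ⨅ π ∈ transportPlans p q, fgwCost d₁ β π

/-- The unit sphere of `ℝ^d`. -/
abbrev UnitSphere (d : ℕ) : Type := Metric.sphere (0 : EuclideanSpace ℝ (Fin d)) 1

/-- The push-forward of `μ` under `x ↦ θᵀ x`. -/
def slice {d : ℕ} (θ : UnitSphere d) (μ : Measure (EuclideanSpace ℝ (Fin d))) : Measure ℝ :=
  μ.map (fun x => inner ℝ (θ : EuclideanSpace ℝ (Fin d)) x)

/-- The surface measure of the unit sphere. -/
def sphereSurface (d : ℕ) : Measure (UnitSphere d) :=
  (volume : Measure (EuclideanSpace ℝ (Fin d))).toSphere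

/-- The uniform probability distribution on the unit sphere. -/
def sphereUniform (d : ℕ) : Measure (UnitSphere d) :=
  (sphereSurface d univ)⁻¹ • sphereSurface d

/-- The normalization constant of the power spherical density. -/
def psConst (κ : ℝ) (d : ℕ) : ℝ :=
  ((2 : ℝ) ^ ((d : ℝ) - 1 + κ) * Real.pi ^ (((d : ℝ) - 1) / 2) *
    (Real.Gamma (((d : ℝ) - 1) / 2 + κ) / Real.Gamma ((d : ℝ) - 1 + κ)))⁻¹

/-- The power spherical distribution: density `C(κ, d) (1 + εᵀ x)^κ` with respect to the surface
measure. -/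
def powerSpherical {d : ℕ} (ε : UnitSphere d) (κ : ℝ) : Measure (UnitSphere d) :=
  (sphereSurface d).withDensity fun x =>
    ENNReal.ofReal (psConst κ d *
      (1 + inner ℝ (ε : EuclideanSpace ℝ (Fin d)) (x : EuclideanSpace ℝ (Fin d))) ^ κ)

/-- Sliced fused Gromov Wasserstein. -/
def sfg {d : ℕ} (d₁ : ℝ → ℝ → ℝ) (μ ν : Measure (EuclideanSpace ℝ (Fin d))) (β : ℝ) : ℝ≥0∞ :=
  ∫⁻ θ, fgw d₁ β (slice θ μ) (slice θ ν) ∂(sphereUniform d)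

/-- Max sliced fused Gromov Wasserstein. -/
def maxSFG {d : ℕ} (d₁ : ℝ → ℝ → ℝ) (μ ν : Measure (EuclideanSpace ℝ (Fin d))) (β : ℝ) : ℝ≥0∞ :=
  ⨆ θ : UnitSphere d, fgw d₁ β (slice θ μ) (slice θ ν)

/-- Power spherical sliced fused Gromov Wasserstein. -/
def pssfg {d : ℕ} (d₁ : ℝ → ℝ → ℝ) (μ ν : Measure (EuclideanSpace ℝ (Fin d))) (β κ : ℝ) : ℝ≥0∞ :=
  ⨆ ε : UnitSphere d, ∫⁻ θ, fgw d₁ β (slice θ μ) (slice θ ν) ∂(powerSpherical ε κ)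

end

/-! Apart from lower semicontinuity, the argument concerns an arbitrary function `F` from the sphere
to `[0, ∞]`, here the discrepancy of the slices.

The constant C(κ, d) is exactly the one making power spherical laws probability measures. This comes
from computing ∫ e^{-|x|} |x|⁻¹ (|x| + εᵀx)^κ dx twice: in polar coordinates, and along the line of
ε and its orthogonal complement (`lintegral_one_add_inner_rpow`). Averages are then at most the
supremum, and bounding 1 + εᵀx by 2 gives the other inequality of (b).

As κ → 0 that inequality becomes sharp, because C(0, d) is the reciprocal of the sphere's area;
Fatou's lemma gives the matching lower bound. As κ → ∞ the laws concentrate at ε, so their averages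
have liminf at least F(ε) when F is lower semicontinuous. For continuous `d₁` this holds
(`lowerSemicontinuous_fgw_slice`): plans between slices are uniformly tight, their weak limits have
the right marginals, and the cost is weakly lower semicontinuous. -/

/-! ### Integration formulas -/

/-- Integration in polar coordinates for non-negative functions. -/
theorem lintegral_eq_lintegral_toSphere {E : Type*} [NormedAddCommGroup E] [NormedSpace ℝ E]
    [FiniteDimensional ℝ E] [Nontrivial E] [MeasurableSpace E] [BorelSpace E] (μ : Measure E)
    [μ.IsAddHaarMeasure] {f : E → ℝ≥0∞} (hf : Measurable f) :
    ∫⁻ x, f x ∂μ = ∫⁻ θ, (∫⁻ r in Ioi (0 : ℝ),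
      ENNReal.ofReal (r ^ (Module.finrank ℝ E - 1)) * f (r • (θ : E))) ∂μ.toSphere := by
  have hg : Measurable fun p : Metric.sphere (0 : E) 1 × Ioi (0 : ℝ) => f (p.2.1 • p.1.1) :=
    hf.comp (by fun_prop)
  calc ∫⁻ x, f x ∂μ = ∫⁻ x : ({(0)}ᶜ : Set E), f x.1 ∂(μ.comap (↑)) := by
        rw [lintegral_subtype_comap (measurableSet_singleton _).compl, restrict_compl_singleton]
    _ = ∫⁻ p, f (p.2.1 • p.1.1) ∂μ.toSphere.prod (.volumeIoiPow (Module.finrank ℝ E - 1)) := by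
        rw [← μ.measurePreserving_homeomorphUnitSphereProd.lintegral_comp hg]
        refine lintegral_congr fun x => ?_
        congr 1
        have : ‖(x : E)‖ ≠ 0 := norm_ne_zero_iff.2 x.2
        simp [smul_smul, mul_inv_cancel₀ this]
    _ = _ := by
        rw [lintegral_prod _ hg.aemeasurable]
        refine lintegral_congr fun θ => ?_
        have hθ : Measurable fun r : Ioi (0 : ℝ) => f (r.1 • θ.1) := hf.comp (by fun_prop)
        refine (lintegral_withDensity_eq_lintegral_mul _ (by fun_prop) hθ).trans ?_
        exact lintegral_subtype_comap measurableSet_Ioi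
          fun r : ℝ => ENNReal.ofReal (r ^ (Module.finrank ℝ E - 1)) * f (r • θ.1)

/-- Fubini's theorem along the line spanned by a unit vector and its orthogonal complement. -/
theorem lintegral_eq_lintegral_orthogonal_line {E : Type*} [NormedAddCommGroup E]
    [InnerProductSpace ℝ E] [FiniteDimensional ℝ E] [MeasurableSpace E] [BorelSpace E]
    {e : E} (he : ‖e‖ = 1) {f : E → ℝ≥0∞} (hf : Measurable f) :
    ∫⁻ x, f x = ∫⁻ y : (Submodule.span ℝ {e})ᗮ, ∫⁻ t : ℝ, f (t • e + y) := by
  set K := Submodule.span ℝ {e}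
  have h₁ : MeasurePreserving (Prod.map
      (LinearIsometryEquiv.toSpanUnitSingleton (𝕜 := ℝ) e he) (id : Kᗮ → Kᗮ)) :=
    (LinearIsometryEquiv.toSpanUnitSingleton (𝕜 := ℝ) e he).measurePreserving.prod
      (MeasurePreserving.id volume)
  have h := (K.orthogonalDecomposition.symm.measurePreserving.comp
    (WithLp.volume_preserving_toLp K Kᗮ)).comp h₁
  have hE : ∀ p : ℝ × Kᗮ, (K.orthogonalDecomposition.symm ∘ WithLp.toLp 2 ∘ Prod.map
      (LinearIsometryEquiv.toSpanUnitSingleton (𝕜 := ℝ) e he) (id : Kᗮ → Kᗮ)) p =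
      p.1 • e + p.2 := fun p => rfl
  rw [← h.lintegral_comp hf]
  refine (lintegral_prod_symm _ (hf.comp h.measurable).aemeasurable).trans ?_
  exact lintegral_congr fun y => lintegral_congr fun t => congrArg f (hE (t, y))

theorem image_half_sub_div {a : ℝ} (ha : 0 < a) :
    (fun s : ℝ => (s - a ^ 2 / s) / 2) '' Ioi 0 = univ := by
  refine eq_univ_of_forall fun t => ?_
  have h1 : |t| < √(t ^ 2 + a ^ 2) := by
    rw [← Real.sqrt_sq_eq_abs]; exact Real.sqrt_lt_sqrt (sq_nonneg _) (by nlinarith)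
  have h2 : √(t ^ 2 + a ^ 2) ^ 2 = t ^ 2 + a ^ 2 := Real.sq_sqrt (by positivity)
  have h3 : 0 < t + √(t ^ 2 + a ^ 2) := by linarith [neg_abs_le t]
  -- The positive root of s² - 2ts - a² = 0.
  refine ⟨t + √(t ^ 2 + a ^ 2), h3, ?_⟩
  simp only
  field_simp
  nlinarith

/-- The change of variable `t = (s - a² / s) / 2` on the real line. -/
theorem lintegral_eq_lintegral_half_sub_div {a : ℝ} (ha : 0 < a) (h : ℝ → ℝ≥0∞) :
    ∫⁻ t, h t = ∫⁻ s in Ioi (0 : ℝ),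
      ENNReal.ofReal ((1 + a ^ 2 / s ^ 2) / 2) * h ((s - a ^ 2 / s) / 2) := by
  have hd : ∀ s ∈ Ioi (0 : ℝ), HasDerivWithinAt (fun s : ℝ => (s - a ^ 2 / s) / 2)
      ((1 + a ^ 2 / s ^ 2) / 2) (Ioi 0) s := fun s hs => by
    have hs' : s ≠ 0 := (mem_Ioi.1 hs).ne'
    have := (((hasDerivAt_id s).sub ((hasDerivAt_inv hs').const_mul (a ^ 2))).div_const 2)
    refine (this.congr_deriv ?_).hasDerivWithinAt
    field_simp
    ring
  have hi : InjOn (fun s : ℝ => (s - a ^ 2 / s) / 2) (Ioi 0) := by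
    intro s hs t ht hst
    have hs' : 0 < s := hs
    have ht' : 0 < t := ht
    simp only at hst
    field_simp at hst
    have : (s - t) * (s * t + a ^ 2) = 0 := by linear_combination hst
    rcases mul_eq_zero.1 this with h | h
    · linarith
    · nlinarith [mul_pos hs' ht', sq_nonneg a]
  have := lintegral_image_eq_lintegral_abs_deriv_mul measurableSet_Ioi hd hi h
  rw [image_half_sub_div ha, Measure.restrict_univ] at this
  rw [this]
  refine setLIntegral_congr_fun measurableSet_Ioi fun s hs => ?_
  rw [abs_of_nonneg (by positivity)]

/-- Under t = (s - a²/s)/2 the root √(t² + a²) becomes (s + a²/s)/2, so its sum with t is s and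
dt/√(t² + a²) = ds/s. The dependence on a is then Gaussian. -/
theorem lintegral_line_exp_neg_norm {a : ℝ} (ha : 0 < a) (κ : ℝ) :
    ∫⁻ t : ℝ, ENNReal.ofReal (Real.exp (-√(t ^ 2 + a ^ 2)) / √(t ^ 2 + a ^ 2) *
      (√(t ^ 2 + a ^ 2) + t) ^ κ) =
    ∫⁻ s in Ioi (0 : ℝ), ENNReal.ofReal (s ^ (κ - 1) * Real.exp (-(1 / 2 * s))) *
      ENNReal.ofReal (Real.exp (-(1 / (2 * s)) * a ^ 2)) := by
  rw [lintegral_eq_lintegral_half_sub_div ha]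
  refine setLIntegral_congr_fun measurableSet_Ioi fun s hs => ?_
  have hs : 0 < s := hs
  have hsq : √(((s - a ^ 2 / s) / 2) ^ 2 + a ^ 2) = (s + a ^ 2 / s) / 2 := by
    rw [Real.sqrt_eq_iff_mul_self_eq (by positivity) (by positivity)]
    field_simp
    ring
  simp only [hsq]
  rw [← ENNReal.ofReal_mul (by positivity), ← ENNReal.ofReal_mul (by positivity)]
  congr 1
  rw [show (s + a ^ 2 / s) / 2 + (s - a ^ 2 / s) / 2 = s by ring,
    show -((s + a ^ 2 / s) / 2) = -(1 / 2 * s) + -(1 / (2 * s)) * a ^ 2 by field_simp; ring,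
    Real.exp_add, Real.rpow_sub_one hs.ne']
  have : s ^ 2 + a ^ 2 ≠ 0 := by positivity
  field_simp

theorem lintegral_exp_neg_mul_norm_sq {V : Type*} [NormedAddCommGroup V] [InnerProductSpace ℝ V]
    [FiniteDimensional ℝ V] [MeasurableSpace V] [BorelSpace V] {b : ℝ} (hb : 0 < b) :
    ∫⁻ v : V, ENNReal.ofReal (Real.exp (-b * ‖v‖ ^ 2)) =
      ENNReal.ofReal ((Real.pi / b) ^ (Module.finrank ℝ V / 2 : ℝ)) := by
  have h := GaussianFourier.integral_rexp_neg_mul_sq_norm (V := V) hb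
  have h0 : 0 < (Real.pi / b) ^ (Module.finrank ℝ V / 2 : ℝ) := by positivity
  rw [← h, ofReal_integral_eq_lintegral_ofReal _ (ae_of_all _ fun _ => (Real.exp_pos _).le)]
  -- A non-integrable function has integral 0 by convention, so a nonzero value forces
  -- integrability.
  exact not_imp_comm.1 integral_undef (by rw [h]; exact h0.ne')

theorem lintegral_rpow_mul_exp_neg_mul_Ioi {a r : ℝ} (ha : 0 < a) (hr : 0 < r) :
    ∫⁻ t in Ioi (0 : ℝ), ENNReal.ofReal (t ^ (a - 1) * Real.exp (-(r * t))) =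
      ENNReal.ofReal ((1 / r) ^ a * Real.Gamma a) := by
  have h := Real.integral_rpow_mul_exp_neg_mul_Ioi ha hr
  have h0 : 0 < (1 / r) ^ a * Real.Gamma a := mul_pos (by positivity) (Real.Gamma_pos_of_pos ha)
  rw [← h, ofReal_integral_eq_lintegral_ofReal]
  · exact not_imp_comm.1 integral_undef (by rw [h]; exact h0.ne')
  · filter_upwards [ae_restrict_mem measurableSet_Ioi] with t ht
    have : 0 < t := ht
    positivity

/-! ### The normalization constant -/

variable {d : ℕ}

theorem nontrivial_euclideanSpace_of_two_le (hd : 2 ≤ d) :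
    Nontrivial (EuclideanSpace ℝ (Fin d)) :=
  Module.nontrivial_of_finrank_pos (R := ℝ) (by simp; omega)

theorem nonempty_unitSphere (hd : 2 ≤ d) : Nonempty (UnitSphere d) :=
  have := nontrivial_euclideanSpace_of_two_le hd
  (NormedSpace.sphere_nonempty.2 zero_le_one).to_subtype

theorem norm_unitSphere (e : UnitSphere d) : ‖(e : EuclideanSpace ℝ (Fin d))‖ = 1 := by simp

theorem finrank_orthogonal_unit (e : UnitSphere d) :
    (Module.finrank ℝ (Submodule.span ℝ {(e : EuclideanSpace ℝ (Fin d))})ᗮ : ℝ) = d - 1 := by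
  have h := (Submodule.span ℝ {(e : EuclideanSpace ℝ (Fin d))}).finrank_add_finrank_orthogonal
  have he : (e : EuclideanSpace ℝ (Fin d)) ≠ 0 := by
    rw [← norm_ne_zero_iff, norm_unitSphere]; exact one_ne_zero
  rw [finrank_span_singleton he, finrank_euclideanSpace_fin] at h
  have h' := congrArg (Nat.cast (R := ℝ)) h
  push_cast at h'
  linarith

theorem one_add_inner_nonneg (e x : UnitSphere d) :
    0 ≤ 1 + inner ℝ (e : EuclideanSpace ℝ (Fin d)) (x : EuclideanSpace ℝ (Fin d)) := by
  have := abs_real_inner_le_norm (e : EuclideanSpace ℝ (Fin d)) x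
  rw [norm_unitSphere, norm_unitSphere] at this
  linarith [(abs_le.1 this).1]

theorem one_add_inner_le_two (e x : UnitSphere d) :
    1 + inner ℝ (e : EuclideanSpace ℝ (Fin d)) (x : EuclideanSpace ℝ (Fin d)) ≤ 2 := by
  have := real_inner_le_norm (e : EuclideanSpace ℝ (Fin d)) x
  rw [norm_unitSphere, norm_unitSphere] at this
  linarith

/-- The power is homogeneous of degree κ, so radius and direction separate; the factor 1/‖x‖ lowers
the Gamma argument from d + κ to d - 1 + κ. -/
theorem lintegral_exp_neg_norm_polar (hd : 2 ≤ d) {κ : ℝ} (hκ : 0 ≤ κ) (e : UnitSphere d) :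
    ∫⁻ x : EuclideanSpace ℝ (Fin d), ENNReal.ofReal (Real.exp (-‖x‖) / ‖x‖ *
      (‖x‖ + inner ℝ (e : EuclideanSpace ℝ (Fin d)) x) ^ κ) =
    (∫⁻ θ : UnitSphere d, ENNReal.ofReal
      ((1 + inner ℝ (e : EuclideanSpace ℝ (Fin d)) (θ : EuclideanSpace ℝ (Fin d))) ^ κ)
      ∂(sphereSurface d)) * ENNReal.ofReal (Real.Gamma ((d : ℝ) - 1 + κ)) := by
  have := nontrivial_euclideanSpace_of_two_le hd
  have hd' : (2 : ℝ) ≤ d := by exact_mod_cast hd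
  rw [lintegral_eq_lintegral_toSphere volume (by fun_prop), ← lintegral_mul_const _ (by fun_prop)]
  refine lintegral_congr fun θ => ?_
  have hG := lintegral_rpow_mul_exp_neg_mul_Ioi (a := (d : ℝ) - 1 + κ) (by linarith) one_pos
  rw [div_one, Real.one_rpow, one_mul] at hG
  rw [← hG, ← lintegral_const_mul _ (by fun_prop)]
  refine setLIntegral_congr_fun measurableSet_Ioi fun r hr => ?_
  have hr : 0 < r := hr
  have h0 := one_add_inner_nonneg e θ
  rw [← ENNReal.ofReal_mul (by positivity), ← ENNReal.ofReal_mul (by positivity)]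
  congr 1
  rw [norm_smul, norm_unitSphere, Real.norm_of_nonneg hr.le, mul_one, inner_smul_right,
    finrank_euclideanSpace_fin,
    show ∀ c : ℝ, r + r * c = r * (1 + c) from fun c => by ring, Real.mul_rpow hr.le h0,
    show (d : ℝ) - 1 + κ - 1 = ((d - 1 : ℕ) : ℝ) + κ - 1 by push_cast [show 1 ≤ d by omega]; ring,
    Real.rpow_sub_one hr.ne', Real.rpow_add hr, Real.rpow_natCast, one_mul]
  field_simp

theorem norm_smul_add_orthogonal (e : UnitSphere d)
    (y : (Submodule.span ℝ {(e : EuclideanSpace ℝ (Fin d))})ᗮ) (t : ℝ) :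
    ‖t • (e : EuclideanSpace ℝ (Fin d)) + y‖ = √(t ^ 2 + ‖y‖ ^ 2) := by
  have h : inner ℝ (e : EuclideanSpace ℝ (Fin d)) (y : EuclideanSpace ℝ (Fin d)) = 0 :=
    Submodule.mem_orthogonal_singleton_iff_inner_right.1 y.2
  rw [← Real.sqrt_sq (norm_nonneg _), norm_add_sq_real, inner_smul_left, h, norm_smul,
    norm_unitSphere]
  simp

theorem inner_smul_add_orthogonal (e : UnitSphere d)
    (y : (Submodule.span ℝ {(e : EuclideanSpace ℝ (Fin d))})ᗮ) (t : ℝ) :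
    inner ℝ (e : EuclideanSpace ℝ (Fin d)) (t • (e : EuclideanSpace ℝ (Fin d)) + y) = t := by
  have h : inner ℝ (e : EuclideanSpace ℝ (Fin d)) (y : EuclideanSpace ℝ (Fin d)) = 0 :=
    Submodule.mem_orthogonal_singleton_iff_inner_right.1 y.2
  rw [inner_add_right, h, inner_smul_right, real_inner_self_eq_norm_sq, norm_unitSphere]
  simp

/-- After the substitution on each line, exchanging the integrals leaves a Gaussian in dimension d -
1, worth (2πs)^((d-1)/2), and then a Gamma integral in s. -/
theorem lintegral_exp_neg_norm_fibration (hd : 2 ≤ d) {κ : ℝ} (hκ : 0 ≤ κ) (e : UnitSphere d) :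
    ∫⁻ x : EuclideanSpace ℝ (Fin d), ENNReal.ofReal (Real.exp (-‖x‖) / ‖x‖ *
      (‖x‖ + inner ℝ (e : EuclideanSpace ℝ (Fin d)) x) ^ κ) =
    ENNReal.ofReal ((2 : ℝ) ^ ((d : ℝ) - 1 + κ) * Real.pi ^ (((d : ℝ) - 1) / 2) *
      Real.Gamma (((d : ℝ) - 1) / 2 + κ)) := by
  have hd' : (2 : ℝ) ≤ d := by exact_mod_cast hd
  have hf := finrank_orthogonal_unit e
  set V := (Submodule.span ℝ {(e : EuclideanSpace ℝ (Fin d))})ᗮ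
  have : Nontrivial V := Module.nontrivial_of_finrank_pos (R := ℝ) (by
    have : (0 : ℝ) < Module.finrank ℝ V := by rw [hf]; linarith
    exact_mod_cast this)
  rw [lintegral_eq_lintegral_orthogonal_line (norm_unitSphere e) (by fun_prop)]
  calc _ = ∫⁻ y : V, ∫⁻ s in Ioi (0 : ℝ),
        ENNReal.ofReal (s ^ (κ - 1) * Real.exp (-(1 / 2 * s))) *
          ENNReal.ofReal (Real.exp (-(1 / (2 * s)) * ‖y‖ ^ 2)) := by
        -- The substitution needs ‖y‖ > 0; the origin is null because the complement has positive
        -- dimension.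
        refine lintegral_congr_ae ?_
        filter_upwards [compl_mem_ae_iff.2 (measure_singleton (0 : V))] with y hy
        rw [← lintegral_line_exp_neg_norm (norm_pos_iff.2 hy)]
        refine lintegral_congr fun t => ?_
        rw [norm_smul_add_orthogonal, inner_smul_add_orthogonal]
    _ = ∫⁻ s in Ioi (0 : ℝ), ENNReal.ofReal (s ^ (κ - 1) * Real.exp (-(1 / 2 * s))) *
          ∫⁻ y : V, ENNReal.ofReal (Real.exp (-(1 / (2 * s)) * ‖y‖ ^ 2)) := by
        rw [lintegral_lintegral_swap (by fun_prop)]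
        exact lintegral_congr fun s => lintegral_const_mul _ (by fun_prop)
    _ = ∫⁻ s in Ioi (0 : ℝ), ENNReal.ofReal ((2 * Real.pi) ^ (((d : ℝ) - 1) / 2)) *
          ENNReal.ofReal (s ^ (((d : ℝ) - 1) / 2 + κ - 1) * Real.exp (-(1 / 2 * s))) := by
        refine setLIntegral_congr_fun measurableSet_Ioi fun s hs => ?_
        have hs : 0 < s := hs
        rw [lintegral_exp_neg_mul_norm_sq (by positivity), ← ENNReal.ofReal_mul (by positivity),
          ← ENNReal.ofReal_mul (by positivity), hf,
          show Real.pi / (1 / (2 * s)) = 2 * Real.pi * s by field_simp,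
          Real.mul_rpow (by positivity) hs.le,
          show ((d : ℝ) - 1) / 2 + κ - 1 = ((d : ℝ) - 1) / 2 + (κ - 1) by ring,
          Real.rpow_add hs]
        congr 1
        ring
    _ = _ := by
        rw [lintegral_const_mul _ (by fun_prop),
          lintegral_rpow_mul_exp_neg_mul_Ioi (by linarith) (by norm_num),
          ← ENNReal.ofReal_mul (by positivity), one_div_one_div,
          Real.mul_rpow zero_le_two Real.pi_pos.le,
          show (d : ℝ) - 1 + κ = ((d : ℝ) - 1) / 2 + (((d : ℝ) - 1) / 2 + κ) by ring,
          Real.rpow_add two_pos (((d : ℝ) - 1) / 2) (((d : ℝ) - 1) / 2 + κ)]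
        congr 1
        generalize (2 : ℝ) ^ (((d : ℝ) - 1) / 2 + κ) = A
        ring

theorem psConst_pos (hd : 2 ≤ d) {κ : ℝ} (hκ : 0 ≤ κ) : 0 < psConst κ d := by
  have hd' : (2 : ℝ) ≤ d := by exact_mod_cast hd
  have h1 := Real.Gamma_pos_of_pos (show 0 < ((d : ℝ) - 1) / 2 + κ by linarith)
  have h2 := Real.Gamma_pos_of_pos (show 0 < (d : ℝ) - 1 + κ by linarith)
  have := Real.pi_pos
  unfold psConst
  positivity

theorem lintegral_one_add_inner_rpow (hd : 2 ≤ d) {κ : ℝ} (hκ : 0 ≤ κ) (e : UnitSphere d) :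
    ∫⁻ θ : UnitSphere d, ENNReal.ofReal
      ((1 + inner ℝ (e : EuclideanSpace ℝ (Fin d)) (θ : EuclideanSpace ℝ (Fin d))) ^ κ)
      ∂(sphereSurface d) = ENNReal.ofReal (psConst κ d)⁻¹ := by
  have hd' : (2 : ℝ) ≤ d := by exact_mod_cast hd
  have h2 := Real.Gamma_pos_of_pos (show 0 < (d : ℝ) - 1 + κ by linarith)
  have h := (lintegral_exp_neg_norm_polar hd hκ e).symm.trans
    (lintegral_exp_neg_norm_fibration hd hκ e)
  have h0 : ENNReal.ofReal (Real.Gamma ((d : ℝ) - 1 + κ)) ≠ 0 := (ENNReal.ofReal_pos.2 h2).ne'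
  rw [mul_comm, ← ENNReal.eq_div_iff h0 ENNReal.ofReal_ne_top, ← ENNReal.ofReal_div_of_pos h2] at h
  rw [h, psConst, inv_inv, mul_div_assoc]

/-- The case κ = 0, where the density is constant; it identifies the limiting law as the uniform
one. -/
theorem sphereSurface_univ (hd : 2 ≤ d) :
    sphereSurface d univ = ENNReal.ofReal (psConst 0 d)⁻¹ := by
  obtain ⟨e⟩ := nonempty_unitSphere hd
  simp [← lintegral_one_add_inner_rpow hd le_rfl e]

theorem tendsto_psConst_zero (hd : 2 ≤ d) :
    Tendsto (fun κ => psConst κ d) (𝓝 0) (𝓝 (psConst 0 d)) := by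
  have hd' : (2 : ℝ) ≤ d := by exact_mod_cast hd
  have hG : ∀ a : ℝ, 0 < a → ContinuousAt (fun κ => Real.Gamma (a + κ)) 0 := fun a ha => by
    refine ContinuousAt.comp (g := Real.Gamma) ?_ (by fun_prop)
    refine (Real.differentiableAt_Gamma fun m => ?_).continuousAt
    have : (0 : ℝ) ≤ m := m.cast_nonneg
    linarith
  have h1 := hG (((d : ℝ) - 1) / 2) (by linarith)
  have h2 := hG ((d : ℝ) - 1) (by linarith)
  have h3 := (Real.Gamma_pos_of_pos (show 0 < (d : ℝ) - 1 + 0 by linarith)).ne'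
  have h0 := (psConst_pos hd le_rfl).ne'
  unfold psConst at h0 ⊢
  refine ContinuousAt.tendsto (f := fun κ : ℝ => (_ : ℝ)) (ContinuousAt.inv₀ ?_ (inv_eq_zero.not.1 h0))
  refine ContinuousAt.mul (ContinuousAt.mul ?_ continuousAt_const) (h1.div h2 h3)
  exact ContinuousAt.rpow continuousAt_const (by fun_prop) (Or.inl two_ne_zero)

theorem sphereSurface_univ_ne_zero (hd : 2 ≤ d) : sphereSurface d univ ≠ 0 := by
  rw [sphereSurface_univ hd]
  exact (ENNReal.ofReal_pos.2 (inv_pos.2 (psConst_pos hd le_rfl))).ne'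

/-! ### Power spherical integrals of arbitrary functions -/

instance : IsFiniteMeasure (sphereSurface d) := by unfold sphereSurface; infer_instance

instance : (sphereSurface d).IsOpenPosMeasure := by unfold sphereSurface; infer_instance

/-- The density is measurable and finite, which suffices even for non-measurable `F`, whose
`lintegral` is a lower integral. -/
theorem lintegral_powerSpherical (e : UnitSphere d) (κ : ℝ) (F : UnitSphere d → ℝ≥0∞) :
    ∫⁻ θ, F θ ∂(powerSpherical e κ) = ∫⁻ θ, ENNReal.ofReal (psConst κ d *
      (1 + inner ℝ (e : EuclideanSpace ℝ (Fin d)) (θ : EuclideanSpace ℝ (Fin d))) ^ κ) * F θ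
        ∂(sphereSurface d) :=
  lintegral_withDensity_eq_lintegral_mul_non_measurable _ (by fun_prop)
    (ae_of_all _ fun _ => ENNReal.ofReal_lt_top) F

theorem isProbabilityMeasure_powerSpherical (hd : 2 ≤ d) {κ : ℝ} (hκ : 0 ≤ κ)
    (e : UnitSphere d) : IsProbabilityMeasure (powerSpherical e κ) := by
  have hc := psConst_pos hd hκ
  constructor
  rw [← lintegral_one, lintegral_powerSpherical]
  simp_rw [mul_one, ENNReal.ofReal_mul hc.le]
  rw [lintegral_const_mul _ (by fun_prop), lintegral_one_add_inner_rpow hd hκ,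
    ← ENNReal.ofReal_mul hc.le, mul_inv_cancel₀ hc.ne', ENNReal.ofReal_one]

/-- Needed with b = 2 on the whole sphere and with b < 2 away from `e`. -/
theorem powerSpherical_density_le (hd : 2 ≤ d) {κ : ℝ} (hκ : 0 ≤ κ) (e θ : UnitSphere d)
    {b : ℝ} (hb : 1 + inner ℝ (e : EuclideanSpace ℝ (Fin d)) (θ : EuclideanSpace ℝ (Fin d)) ≤ b) :
    ENNReal.ofReal (psConst κ d *
      (1 + inner ℝ (e : EuclideanSpace ℝ (Fin d)) (θ : EuclideanSpace ℝ (Fin d))) ^ κ) ≤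
    ENNReal.ofReal (b ^ κ * psConst κ d) := by
  have hc := psConst_pos hd hκ
  refine ENNReal.ofReal_le_ofReal ?_
  rw [mul_comm]
  exact mul_le_mul_of_nonneg_right (Real.rpow_le_rpow (one_add_inner_nonneg e θ) hb hκ) hc.le

theorem lintegral_powerSpherical_le (hd : 2 ≤ d) {κ : ℝ} (hκ : 0 ≤ κ) (e : UnitSphere d)
    (F : UnitSphere d → ℝ≥0∞) :
    ∫⁻ θ, F θ ∂(powerSpherical e κ) ≤
      ENNReal.ofReal ((2 : ℝ) ^ κ * psConst κ d) * ∫⁻ θ, F θ ∂(sphereSurface d) := by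
  rw [lintegral_powerSpherical, ← lintegral_const_mul' _ _ ENNReal.ofReal_ne_top]
  exact lintegral_mono fun θ =>
    mul_le_mul_left (powerSpherical_density_le hd hκ e θ (one_add_inner_le_two e θ)) _

theorem lintegral_sphereSurface_eq (hd : 2 ≤ d) (F : UnitSphere d → ℝ≥0∞) :
    ∫⁻ θ, F θ ∂(sphereSurface d) = sphereSurface d univ * ∫⁻ θ, F θ ∂(sphereUniform d) := by
  rw [sphereUniform, lintegral_smul_measure, smul_eq_mul, ← mul_assoc,
    ENNReal.mul_inv_cancel (sphereSurface_univ_ne_zero hd) (measure_ne_top _ _), one_mul]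

theorem lintegral_sphereUniform_eq (hd : 2 ≤ d) (F : UnitSphere d → ℝ≥0∞) :
    ∫⁻ θ, F θ ∂(sphereUniform d) =
      ENNReal.ofReal (psConst 0 d) * ∫⁻ θ, F θ ∂(sphereSurface d) := by
  rw [sphereUniform, lintegral_smul_measure, smul_eq_mul, sphereSurface_univ hd,
    ENNReal.ofReal_inv_of_pos (psConst_pos hd le_rfl), inv_inv]

/-! ### The limit κ → 0 -/

/-- The cone over a point lies in a line, a proper subspace since d ≥ 2, hence null. -/
theorem sphereSurface_singleton (hd : 2 ≤ d) (x : UnitSphere d) : sphereSurface d {x} = 0 := by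
  rw [sphereSurface, Measure.toSphere_apply' _ (measurableSet_singleton x)]
  have hne : Submodule.span ℝ {(x : EuclideanSpace ℝ (Fin d))} ≠ ⊤ := fun h => by
    have h1 := finrank_span_le_card (R := ℝ) {(x : EuclideanSpace ℝ (Fin d))}
    rw [h, finrank_top, finrank_euclideanSpace_fin] at h1
    simp at h1
    omega
  have h0 := Measure.addHaar_submodule (volume : Measure (EuclideanSpace ℝ (Fin d))) _ hne
  refine mul_eq_zero_of_right _ (measure_mono_null ?_ h0)
  rintro _ ⟨r, -, _, ⟨y, rfl, rfl⟩, rfl⟩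
  exact Submodule.smul_mem _ _ (Submodule.mem_span_singleton_self _)

/-- By ‖e + θ‖² = 2(1 + eᵀθ), the base vanishes only at θ = -e. Positivity makes its powers
continuous in the exponent at 0. -/
theorem ae_one_add_inner_pos (hd : 2 ≤ d) (e : UnitSphere d) : ∀ᵐ θ : UnitSphere d ∂(sphereSurface d),
    0 < 1 + inner ℝ (e : EuclideanSpace ℝ (Fin d)) (θ : EuclideanSpace ℝ (Fin d)) := by
  filter_upwards [compl_mem_ae_iff.2 (sphereSurface_singleton hd (-e))] with θ hθ
  refine (one_add_inner_nonneg e θ).lt_of_ne' fun h => hθ ?_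
  have h1 : ‖(e : EuclideanSpace ℝ (Fin d)) + θ‖ ^ 2 = 0 := by
    rw [norm_add_sq_real, norm_unitSphere, norm_unitSphere]
    linarith
  have h2 : (e : EuclideanSpace ℝ (Fin d)) + θ = 0 := by simpa using h1
  exact Subtype.ext (by simpa using (neg_eq_of_add_eq_zero_right h2).symm)

theorem lintegral_sphereUniform_le_liminf (hd : 2 ≤ d) (e : UnitSphere d)
    (F : UnitSphere d → ℝ≥0∞) :
    ∫⁻ θ, F θ ∂(sphereUniform d) ≤
      liminf (fun κ : ℝ => ∫⁻ θ, F θ ∂(powerSpherical e κ)) (𝓝[>] 0) := by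
  -- Fatou's lemma needs measurability, so `F` is replaced by a measurable minorant with the same
  -- surface integral.
  obtain ⟨G, hG, hGF, hint⟩ := exists_measurable_le_lintegral_eq (sphereSurface d) F
  rw [lintegral_sphereUniform_eq hd, hint, ← lintegral_const_mul _ hG]
  calc _ ≤ ∫⁻ θ, liminf (fun κ : ℝ => ENNReal.ofReal (psConst κ d *
          (1 + inner ℝ (e : EuclideanSpace ℝ (Fin d)) (θ : EuclideanSpace ℝ (Fin d))) ^ κ) * G θ)
          (𝓝[>] 0) ∂(sphereSurface d) := by
        refine lintegral_mono_ae ?_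
        filter_upwards [ae_one_add_inner_pos hd e] with θ hθ
        refine (Tendsto.liminf_eq ?_).ge
        have h0 := psConst_pos hd le_rfl
        refine ENNReal.Tendsto.mul_const (ENNReal.tendsto_ofReal ?_)
          (Or.inl (ENNReal.ofReal_pos.2 h0).ne')
        have h1 := (tendsto_psConst_zero hd).mul
          ((Real.continuous_const_rpow hθ.ne').tendsto 0)
        rw [Real.rpow_zero, mul_one] at h1
        exact h1.mono_left nhdsWithin_le_nhds
    _ ≤ liminf (fun κ : ℝ => ∫⁻ θ, ENNReal.ofReal (psConst κ d *
          (1 + inner ℝ (e : EuclideanSpace ℝ (Fin d)) (θ : EuclideanSpace ℝ (Fin d))) ^ κ) * G θ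
          ∂(sphereSurface d)) (𝓝[>] 0) := lintegral_liminf_le fun κ => by fun_prop
    _ ≤ _ := by
        refine liminf_le_liminf (Eventually.of_forall fun κ => ?_)
        rw [lintegral_powerSpherical]
        gcongr with θ
        exact hGF θ

/-- The upper bound 2^κ C(κ, d) ∫ F dσ is uniform in the location and converges to the uniform
average; for the lower bound any single location suffices. -/
theorem tendsto_iSup_lintegral_powerSpherical_zero (hd : 2 ≤ d) (F : UnitSphere d → ℝ≥0∞) :
    Tendsto (fun κ : ℝ => ⨆ e, ∫⁻ θ, F θ ∂(powerSpherical e κ)) (𝓝[>] 0)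
      (𝓝 (∫⁻ θ, F θ ∂(sphereUniform d))) := by
  obtain ⟨e⟩ := nonempty_unitSphere hd
  have h0 := psConst_pos hd le_rfl
  have hub : Tendsto (fun κ : ℝ => ENNReal.ofReal ((2 : ℝ) ^ κ * psConst κ d) *
      ∫⁻ θ, F θ ∂(sphereSurface d)) (𝓝[>] 0) (𝓝 (∫⁻ θ, F θ ∂(sphereUniform d))) := by
    rw [lintegral_sphereUniform_eq hd]
    refine ENNReal.Tendsto.mul_const (ENNReal.tendsto_ofReal ?_)
      (Or.inl (ENNReal.ofReal_pos.2 h0).ne')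
    have h1 := ((Real.continuous_const_rpow two_ne_zero).tendsto 0).mul (tendsto_psConst_zero hd)
    rw [Real.rpow_zero, one_mul] at h1
    exact h1.mono_left nhdsWithin_le_nhds
  refine tendsto_of_le_liminf_of_limsup_le ?_ ?_
  · exact (lintegral_sphereUniform_le_liminf hd e F).trans
      (liminf_le_liminf (Eventually.of_forall fun κ =>
        le_iSup (fun e => ∫⁻ θ, F θ ∂(powerSpherical e κ)) e))
  · rw [← hub.limsup_eq]
    refine limsup_le_limsup ?_
    filter_upwards [self_mem_nhdsWithin] with κ hκ
    exact iSup_le fun e => lintegral_powerSpherical_le hd (le_of_lt hκ) e F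

/-! ### Concentration and the limit κ → ∞ -/

/-- Power spherical laws concentrate at their location parameter as the scale goes to infinity. -/
theorem tendsto_powerSpherical_compl_nhds (hd : 2 ≤ d) (e : UnitSphere d) {U : Set (UnitSphere d)}
    (hU : U ∈ 𝓝 e) : Tendsto (fun κ : ℝ => powerSpherical e κ Uᶜ) atTop (𝓝 0) := by
  obtain ⟨r, hr, hrU⟩ := Metric.mem_nhds_iff.1 hU
  -- Since ‖θ - e‖² = 2 - 2eᵀθ, leaving the ball of radius r costs r²/2 in eᵀθ; the cap at 1 keeps 2
  -- - δ positive.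
  set δ := min (r ^ 2 / 2) 1 with hδ
  have hδ0 : 0 < δ := lt_min (by positivity) one_pos
  have hδ1 : δ ≤ 1 := min_le_right _ _
  have hUc : ∀ θ ∈ Uᶜ,
      1 + inner ℝ (e : EuclideanSpace ℝ (Fin d)) (θ : EuclideanSpace ℝ (Fin d)) ≤ 2 - δ := by
    intro θ hθ
    by_contra! h
    refine hθ (hrU ?_)
    rw [Metric.mem_ball, Subtype.dist_eq, dist_eq_norm]
    have h1 := norm_sub_sq_real (θ : EuclideanSpace ℝ (Fin d)) e
    rw [norm_unitSphere, norm_unitSphere, real_inner_comm] at h1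
    have h2 : δ ≤ r ^ 2 / 2 := min_le_left _ _
    exact lt_of_pow_lt_pow_left₀ 2 hr.le (by linarith)
  set V : Set (UnitSphere d) := {θ | 2 - δ / 2 <
    1 + inner ℝ (e : EuclideanSpace ℝ (Fin d)) (θ : EuclideanSpace ℝ (Fin d))} with hV
  have hVo : IsOpen V := isOpen_lt continuous_const (by fun_prop)
  have hVne : V.Nonempty := ⟨e, by
    rw [hV, mem_ofPred_eq, real_inner_self_eq_norm_sq, norm_unitSphere]
    linarith⟩
  have hVpos : 0 < (sphereSurface d).real V :=
    ENNReal.toReal_pos (hVo.measure_pos _ hVne).ne' (measure_ne_top _ _)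
  -- No asymptotics of C(κ, d) are needed: total mass 1, tested on the cap `V`, bounds it. Off `U`
  -- the ratio (2 - δ)/(2 - δ/2) < 1 then gives geometric decay.
  have hc : ∀ κ : ℝ, 0 ≤ κ → psConst κ d * (2 - δ / 2) ^ κ * (sphereSurface d).real V ≤ 1 := by
    intro κ hκ
    have hc := psConst_pos hd hκ
    have := isProbabilityMeasure_powerSpherical hd hκ e
    have h : ENNReal.ofReal (psConst κ d * (2 - δ / 2) ^ κ) * sphereSurface d V ≤ 1 := by
      refine le_trans ?_ (prob_le_one (μ := powerSpherical e κ) (s := V))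
      rw [powerSpherical, withDensity_apply _ hVo.measurableSet, ← setLIntegral_const]
      refine setLIntegral_mono' hVo.measurableSet fun θ hθ => ENNReal.ofReal_le_ofReal ?_
      have hθ : 2 - δ / 2 <
        1 + inner ℝ (e : EuclideanSpace ℝ (Fin d)) (θ : EuclideanSpace ℝ (Fin d)) := hθ
      gcongr
      linarith
    have h' := ENNReal.toReal_mono ENNReal.one_ne_top h
    rwa [ENNReal.toReal_mul, ENNReal.toReal_ofReal
      (mul_nonneg hc.le (Real.rpow_nonneg (by linarith) _)), ENNReal.toReal_one] at h'
  have hbound : ∀ κ : ℝ, 0 ≤ κ → powerSpherical e κ Uᶜ ≤ ENNReal.ofReal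
      (((2 - δ) / (2 - δ / 2)) ^ κ * ((sphereSurface d).real V)⁻¹) * sphereSurface d univ := by
    intro κ hκ
    have hUc' : Uᶜ ⊆ {θ : UnitSphere d |
        1 + inner ℝ (e : EuclideanSpace ℝ (Fin d)) (θ : EuclideanSpace ℝ (Fin d)) ≤ 2 - δ} := hUc
    refine (measure_mono hUc').trans ?_
    have hm : MeasurableSet {θ : UnitSphere d |
        1 + inner ℝ (e : EuclideanSpace ℝ (Fin d)) (θ : EuclideanSpace ℝ (Fin d)) ≤ 2 - δ} :=
      measurableSet_le (by fun_prop) measurable_const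
    rw [powerSpherical, withDensity_apply _ hm]
    refine (setLIntegral_mono' hm fun θ hθ =>
      (powerSpherical_density_le hd hκ e θ hθ).trans (ENNReal.ofReal_le_ofReal ?_)).trans
      ((setLIntegral_le_lintegral _ _).trans_eq (lintegral_const _))
    have h2 : 0 < (2 - δ / 2) ^ κ := Real.rpow_pos_of_pos (by linarith) _
    rw [Real.div_rpow (by linarith) (by linarith), div_mul_eq_mul_div, mul_div_assoc]
    refine mul_le_mul_of_nonneg_left ?_ (Real.rpow_nonneg (by linarith) _)
    rw [le_div_iff₀ h2, ← one_div, le_div_iff₀ hVpos]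
    exact hc κ hκ
  have hlim : Tendsto (fun κ : ℝ => ENNReal.ofReal
      (((2 - δ) / (2 - δ / 2)) ^ κ * ((sphereSurface d).real V)⁻¹) * sphereSurface d univ)
      atTop (𝓝 0) := by
    have h1 : Tendsto (fun κ : ℝ => ((2 - δ) / (2 - δ / 2)) ^ κ) atTop (𝓝 0) := by
      refine tendsto_rpow_atTop_of_base_lt_one _ ?_ ?_
      · have : 0 ≤ (2 - δ) / (2 - δ / 2) := div_nonneg (by linarith) (by linarith)
        linarith
      · rw [div_lt_one (by linarith)]; linarith
    have h2 := ENNReal.tendsto_ofReal (h1.mul_const ((sphereSurface d).real V)⁻¹)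
    rw [zero_mul, ENNReal.ofReal_zero] at h2
    simpa using ENNReal.Tendsto.mul_const h2 (Or.inr (measure_ne_top (sphereSurface d) univ))
  refine tendsto_of_tendsto_of_tendsto_of_le_of_le' tendsto_const_nhds hlim
    (Eventually.of_forall fun _ => zero_le) ?_
  filter_upwards [eventually_ge_atTop 0] with κ hκ using hbound κ hκ

/-- For c' < F(e), F exceeds c' on an open neighbourhood of e, whose mass tends to 1. -/
theorem le_liminf_lintegral_powerSpherical (hd : 2 ≤ d) (e : UnitSphere d)
    {F : UnitSphere d → ℝ≥0∞} (hF : LowerSemicontinuousAt F e) :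
    F e ≤ liminf (fun κ : ℝ => ∫⁻ θ, F θ ∂(powerSpherical e κ)) atTop := by
  refine le_of_forall_lt fun c hc => ?_
  obtain ⟨c', hcc', hc'⟩ := exists_between hc
  refine hcc'.trans_le ?_
  obtain ⟨U, hUF, hUo, heU⟩ := eventually_nhds_iff.1 (hF c' hc')
  have hc'top : c' ≠ ∞ := (hc'.trans_le le_top).ne
  have h1 : Tendsto (fun κ : ℝ => c' * (1 - powerSpherical e κ Uᶜ)) atTop (𝓝 c') := by
    have h := ENNReal.Tendsto.const_mul (a := c') (ENNReal.Tendsto.sub tendsto_const_nhds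
      (tendsto_powerSpherical_compl_nhds hd e (hUo.mem_nhds heU)) (Or.inl ENNReal.one_ne_top))
      (Or.inr hc'top)
    simpa using h
  rw [← h1.liminf_eq]
  refine liminf_le_liminf ?_
  filter_upwards [eventually_ge_atTop 0] with κ hκ
  have := isProbabilityMeasure_powerSpherical hd hκ e
  rw [← prob_compl_eq_one_sub hUo.measurableSet.compl, compl_compl, ← setLIntegral_const]
  exact (setLIntegral_mono' hUo.measurableSet fun θ hθ => (hUF θ hθ).le).trans
    (setLIntegral_le_lintegral _ _)

theorem lintegral_powerSpherical_le_iSup (hd : 2 ≤ d) {κ : ℝ} (hκ : 0 ≤ κ) (e : UnitSphere d)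
    (F : UnitSphere d → ℝ≥0∞) : ∫⁻ θ, F θ ∂(powerSpherical e κ) ≤ ⨆ θ, F θ := by
  have := isProbabilityMeasure_powerSpherical hd hκ e
  refine (lintegral_mono (le_iSup F)).trans_eq ?_
  rw [lintegral_const, measure_univ, mul_one]

theorem tendsto_iSup_lintegral_powerSpherical_atTop (hd : 2 ≤ d) {F : UnitSphere d → ℝ≥0∞}
    (hF : LowerSemicontinuous F) :
    Tendsto (fun κ : ℝ => ⨆ e, ∫⁻ θ, F θ ∂(powerSpherical e κ)) atTop (𝓝 (⨆ θ, F θ)) := by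
  refine tendsto_of_le_liminf_of_limsup_le ?_ ?_
  · refine iSup_le fun e => (le_liminf_lintegral_powerSpherical hd e (hF e)).trans ?_
    exact liminf_le_liminf (Eventually.of_forall fun κ =>
      le_iSup (fun e => ∫⁻ θ, F θ ∂(powerSpherical e κ)) e)
  · refine limsup_le_of_le (h := ?_)
    filter_upwards [eventually_ge_atTop 0] with κ hκ
    exact iSup_le fun e => lintegral_powerSpherical_le_iSup hd hκ e F

/-! ### Lower semicontinuity of the sliced discrepancy -/

theorem lintegral_ofReal_le_liminf_of_tendsto {X : Type*} [MeasurableSpace X] [TopologicalSpace X]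
    [OpensMeasurableSpace X] [HasOuterApproxClosed X] {p : ProbabilityMeasure X}
    {q : ℕ → ProbabilityMeasure X} (h : Tendsto q atTop (𝓝 p)) {f : X → ℝ} (hf : Continuous f)
    (h0 : 0 ≤ f) : ∫⁻ x, ENNReal.ofReal (f x) ∂(p : Measure X) ≤
      liminf (fun n => ∫⁻ x, ENNReal.ofReal (f x) ∂(q n : Measure X)) atTop :=
  lintegral_le_liminf_lintegral_of_forall_isOpen_measure_le_liminf_measure hf h0
    fun _ hG => ProbabilityMeasure.le_liminf_measure_open_of_tendsto h hG

theorem ENNReal.liminf_add_liminf_le {ι : Type*} {l : Filter ι} {u v : ι → ℝ≥0∞} :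
    liminf u l + liminf v l ≤ liminf (fun i => u i + v i) l := by
  rw [liminf_eq_iSup_iInf, liminf_eq_iSup_iInf, liminf_eq_iSup_iInf]
  refine ENNReal.biSup_add_biSup_le' ⟨univ, univ_mem⟩ ⟨univ, univ_mem⟩ fun s hs t ht => ?_
  refine le_iSup₂_of_le (s ∩ t) (inter_mem hs ht) (le_iInf₂ fun i hi => ?_)
  exact add_le_add (iInf₂_le i hi.1) (iInf₂_le i hi.2)

/-- Both integrands are continuous and non-negative, so the portmanteau inequality applies to each;
for the quadratic term, π ↦ π ⊗ π is weakly continuous. -/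
theorem fgwCost_le_liminf {d₁ : ℝ → ℝ → ℝ} (h0 : ∀ x y, 0 ≤ d₁ x y)
    (hc : Continuous (Function.uncurry d₁)) (β : ℝ) {p : ProbabilityMeasure (ℝ × ℝ)}
    {q : ℕ → ProbabilityMeasure (ℝ × ℝ)} (h : Tendsto q atTop (𝓝 p)) :
    fgwCost d₁ β p ≤ liminf (fun n => fgwCost d₁ β (q n)) atTop := by
  have h2 : Tendsto (fun n => (q n).prod (q n)) atTop (𝓝 (p.prod p)) :=
    (ProbabilityMeasure.continuous_prod.tendsto (p, p)).comp (h.prodMk_nhds h)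
  have i1 := lintegral_ofReal_le_liminf_of_tendsto h (f := fun z => d₁ z.1 z.2) hc
    fun z => h0 _ _
  have i2 := lintegral_ofReal_le_liminf_of_tendsto h2
    (f := fun z : (ℝ × ℝ) × ℝ × ℝ => (d₁ z.1.1 z.2.1 - d₁ z.1.2 z.2.2) ^ 2)
    (((hc.comp (f := fun z : (ℝ × ℝ) × ℝ × ℝ => (z.1.1, z.2.1)) (by fun_prop)).sub
      (hc.comp (f := fun z : (ℝ × ℝ) × ℝ × ℝ => (z.1.2, z.2.2)) (by fun_prop))).pow 2)
    fun z => sq_nonneg _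
  unfold fgwCost
  refine le_trans (add_le_add (mul_le_mul_right i1 _) (mul_le_mul_right i2 _)) ?_
  refine le_trans (add_le_add ?_ ?_) ENNReal.liminf_add_liminf_le
  · exact le_trans (by rw [liminf_const]) ENNReal.le_liminf_mul
  · exact le_trans (by rw [liminf_const]; rfl) ENNReal.le_liminf_mul

theorem slice_compl_Icc_le (θ : UnitSphere d) (μ : Measure (EuclideanSpace ℝ (Fin d)))
    (R : ℝ) : slice θ μ (Icc (-R) R)ᶜ ≤ μ (Metric.closedBall 0 R)ᶜ := by
  rw [slice, Measure.map_apply (by fun_prop) measurableSet_Icc.compl]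
  refine measure_mono fun x hx hxR => hx ?_
  rw [mem_closedBall_zero_iff] at hxR
  have := abs_real_inner_le_norm (θ : EuclideanSpace ℝ (Fin d)) x
  rw [norm_unitSphere, one_mul] at this
  exact abs_le.1 (this.trans hxR)

/-- As |θᵀx| ≤ ‖x‖, the tails of all slices are controlled by those of μ and ν, uniformly in θ; a
plan's tail is at most the sum of its marginals' tails. -/
theorem isTightMeasureSet_transportPlans_slice (μ ν : Measure (EuclideanSpace ℝ (Fin d)))
    [IsProbabilityMeasure μ] [IsProbabilityMeasure ν] :
    IsTightMeasureSet (⋃ θ : UnitSphere d, transportPlans (slice θ μ) (slice θ ν)) := by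
  rw [isTightMeasureSet_iff_exists_isCompact_measure_compl_le]
  intro ε hε
  have hball : ∀ ρ : Measure (EuclideanSpace ℝ (Fin d)), IsProbabilityMeasure ρ →
      ∀ᶠ R : ℝ in atTop, ρ (Metric.closedBall 0 R)ᶜ ≤ ε / 2 := fun ρ _ =>
    (tendsto_measure_compl_closedBall_of_isTightMeasureSet (S := {ρ})
      isTightMeasureSet_singleton 0).eventually_le_const (ENNReal.half_pos hε.ne') |>.mono
        fun R hR => by simpa using hR
  obtain ⟨R, hμ, hν⟩ := ((hball μ inferInstance).and (hball ν inferInstance)).exists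
  refine ⟨Icc (-R) R ×ˢ Icc (-R) R, isCompact_Icc.prod isCompact_Icc, fun π hπ => ?_⟩
  obtain ⟨θ, h1, h2⟩ := mem_iUnion.1 hπ
  calc π (Icc (-R) R ×ˢ Icc (-R) R)ᶜ
      ≤ π (Prod.fst ⁻¹' (Icc (-R) R)ᶜ ∪ Prod.snd ⁻¹' (Icc (-R) R)ᶜ) := by
        refine measure_mono fun z hz => ?_
        by_contra h
        simp only [mem_union, mem_preimage, mem_compl_iff, not_or, not_not] at h
        exact hz ⟨h.1, h.2⟩
    _ ≤ slice θ μ (Icc (-R) R)ᶜ + slice θ ν (Icc (-R) R)ᶜ := by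
        rw [← h1, ← h2, Measure.map_apply measurable_fst measurableSet_Icc.compl,
          Measure.map_apply measurable_snd measurableSet_Icc.compl]
        exact measure_union_le _ _
    _ ≤ ε / 2 + ε / 2 := add_le_add ((slice_compl_Icc_le θ μ R).trans hμ)
        ((slice_compl_Icc_le θ ν R).trans hν)
    _ = ε := ENNReal.add_halves ε

instance (θ : UnitSphere d) (μ : Measure (EuclideanSpace ℝ (Fin d)))
    [IsProbabilityMeasure μ] : IsProbabilityMeasure (slice θ μ) :=
  Measure.isProbabilityMeasure_map (by fun_prop)

/-- `slice` as a map to bundled probability measures. -/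
noncomputable def sliceProb (θ : UnitSphere d) (μ : Measure (EuclideanSpace ℝ (Fin d)))
    [IsProbabilityMeasure μ] : ProbabilityMeasure ℝ :=
  ⟨slice θ μ, inferInstance⟩

theorem tendsto_sliceProb {θ : UnitSphere d} {u : ℕ → UnitSphere d}
    (hu : Tendsto u atTop (𝓝 θ)) (μ : Measure (EuclideanSpace ℝ (Fin d)))
    [IsProbabilityMeasure μ] :
    Tendsto (fun n => sliceProb (u n) μ) atTop (𝓝 (sliceProb θ μ)) := by
  rw [ProbabilityMeasure.tendsto_iff_forall_integral_tendsto]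
  intro f
  simp only [sliceProb, ProbabilityMeasure.coe_mk, slice]
  have hmap : ∀ η : UnitSphere d,
      ∫ x, f x ∂(μ.map fun x => inner ℝ (η : EuclideanSpace ℝ (Fin d)) x) =
      ∫ x, f (inner ℝ (η : EuclideanSpace ℝ (Fin d)) x) ∂μ := fun η =>
    integral_map (by fun_prop) f.continuous.aestronglyMeasurable
  simp_rw [hmap]
  refine tendsto_integral_of_dominated_convergence (fun _ => ‖f‖)
    (fun n => (f.continuous.comp (by fun_prop)).aestronglyMeasurable) (integrable_const _)
    (fun n => ae_of_all _ fun x => f.norm_coe_le_norm _) (ae_of_all _ fun x => ?_)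
  exact ((f.continuous.comp (f := fun η : UnitSphere d =>
    inner ℝ (η : EuclideanSpace ℝ (Fin d)) x) (by fun_prop)).tendsto θ).comp hu

/-- Marginal constraints survive weak limits, even when the prescribed marginals vary, by uniqueness
of limits. -/
theorem map_eq_of_tendsto {f : ℝ × ℝ → ℝ} (hf : Continuous f) {p : ProbabilityMeasure (ℝ × ℝ)}
    {q : ℕ → ProbabilityMeasure (ℝ × ℝ)} (h : Tendsto q atTop (𝓝 p))
    {r : ProbabilityMeasure ℝ} {s : ℕ → ProbabilityMeasure ℝ} (hs : Tendsto s atTop (𝓝 r))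
    (hqs : ∀ n, (q n : Measure (ℝ × ℝ)).map f = s n) : (p : Measure (ℝ × ℝ)).map f = r := by
  have h1 := ProbabilityMeasure.tendsto_map_of_tendsto_of_continuous q p h hf
  have h2 : (fun n => (q n).map hf.measurable.aemeasurable) = s :=
    funext fun n => Subtype.ext (hqs n)
  rw [h2] at h1
  have h3 := tendsto_nhds_unique h1 hs
  exact congrArg (fun r : ProbabilityMeasure ℝ => (r : Measure ℝ)) h3

theorem lowerSemicontinuous_fgw_slice {d₁ : ℝ → ℝ → ℝ} (h0 : ∀ x y, 0 ≤ d₁ x y)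
    (hc : Continuous (Function.uncurry d₁)) (β : ℝ) (μ ν : Measure (EuclideanSpace ℝ (Fin d)))
    [IsProbabilityMeasure μ] [IsProbabilityMeasure ν] :
    LowerSemicontinuous fun θ : UnitSphere d => fgw d₁ β (slice θ μ) (slice θ ν) := by
  intro θ c hc'
  -- A failure at θ gives a sequence u → θ with values at most c, strictly below the value at θ.
  by_contra hfreq
  obtain ⟨u, hu, hle⟩ := exists_seq_forall_of_frequently (not_eventually.1 hfreq)
  -- The room between c and b gives plans of cost below b without requiring the infimum to be
  -- attained.
  obtain ⟨b, hcb, hb⟩ := exists_between hc'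
  have hplan : ∀ n, ∃ π ∈ transportPlans (slice (u n) μ) (slice (u n) ν), fgwCost d₁ β π < b := by
    intro n
    have := (not_lt.1 (hle n)).trans_lt hcb
    simpa only [fgw, iInf_lt_iff, exists_prop] using this
  choose π hπ hcost using hplan
  have hprob : ∀ n, IsProbabilityMeasure (π n) := fun n => by
    have := (hπ n).1
    have h1 : IsProbabilityMeasure ((π n).map Prod.fst) := this ▸ inferInstance
    exact Measure.isProbabilityMeasure_of_map Prod.fst
  let q : ℕ → ProbabilityMeasure (ℝ × ℝ) := fun n => ⟨π n, hprob n⟩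
  -- Prokhorov's theorem; a limit plan at θ will have cost at most b, a contradiction.
  have hK : IsCompact (closure (range q)) := isCompact_closure_of_isTightMeasureSet
    ((isTightMeasureSet_transportPlans_slice μ ν).subset (by
      rintro _ ⟨_, ⟨n, rfl⟩, rfl⟩
      exact mem_iUnion.2 ⟨u n, hπ n⟩))
  obtain ⟨p, -, φ, hφ, hp⟩ := hK.tendsto_subseq fun n => subset_closure (mem_range_self n)
  have huφ := hu.comp hφ.tendsto_atTop
  have hmem : (p : Measure (ℝ × ℝ)) ∈ transportPlans (slice θ μ) (slice θ ν) :=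
    ⟨map_eq_of_tendsto continuous_fst hp (tendsto_sliceProb huφ μ) fun n => (hπ (φ n)).1,
      map_eq_of_tendsto continuous_snd hp (tendsto_sliceProb huφ ν) fun n => (hπ (φ n)).2⟩
  have h1 : fgwCost d₁ β p ≤ b := (fgwCost_le_liminf h0 hc β hp).trans
    (liminf_le_of_frequently_le' (Frequently.of_forall fun n => (hcost (φ n)).le))
  exact absurd ((iInf₂_le _ hmem).trans h1) (not_le.2 hb)

theorem theorem8 (d : ℕ) (hd : 2 ≤ d) (d₁ : ℝ → ℝ → ℝ) (hd₁ : IsPseudoMetricOnReal d₁)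
    (hmeas : Measurable (Function.uncurry d₁)) (β : ℝ) (hβ : β ∈ Set.Icc (0 : ℝ) 1)
    (μ ν : Measure (EuclideanSpace ℝ (Fin d))) [IsProbabilityMeasure μ] [IsProbabilityMeasure ν] :
    Tendsto (fun κ : ℝ => pssfg d₁ μ ν β κ) (𝓝[>] 0) (𝓝 (sfg d₁ μ ν β)) ∧
    (Continuous (Function.uncurry d₁) →
      Tendsto (fun κ : ℝ => pssfg d₁ μ ν β κ) atTop (𝓝 (maxSFG d₁ μ ν β))) ∧
    ∀ κ : ℝ, 0 < κ →
      pssfg d₁ μ ν β κ ≤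
        ENNReal.ofReal ((2 : ℝ) ^ κ * psConst κ d) * sphereSurface d univ * sfg d₁ μ ν β ∧
      pssfg d₁ μ ν β κ ≤ maxSFG d₁ μ ν β := by
  refine ⟨tendsto_iSup_lintegral_powerSpherical_zero hd _,
    fun hc => tendsto_iSup_lintegral_powerSpherical_atTop hd
      (lowerSemicontinuous_fgw_slice hd₁.nonneg hc β μ ν), fun κ hκ =>
    ⟨iSup_le fun e => (lintegral_powerSpherical_le hd hκ.le e _).trans_eq ?_,
      iSup_le fun e => lintegral_powerSpherical_le_iSup hd hκ.le e _⟩⟩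
  rw [lintegral_sphereSurface_eq hd, sfg, mul_assoc]
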